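/- Consider $N\ge 1$ agents $\dot x_i=Ax_i+Bu_i$, $i\in V$, $|V|=N$, with $x_i\in\mathbb R^n$, $u_i\in\mathbb R^m$ and real matrices $A,B$, and a weighted directed graph on $V$ with weights $w_{ij}\ge 0$, where $w_{ij}>0$ if and only if $(j,i)$ is an edge, i.e. $j$ belongs to the set $N_i$ of neighbors of $i$. Assume that the graph has a directed spanning tree $\mathcal T$; let $r$ be its root and, for $i\neq r$, let $k_i$ be the parent of $i$, so that $e_i=(k_i,i)$, $i\ne r$, are the edges of $\mathcal T$. The control protocol is $u_i=K_iz_i$ with $z_i=\sum_{j\in N_i}w_{ij}(x_j-x_i)$ and gains $K_i\in\mathbb R^{m\times n}$, $i\in V$. Gains $(K_i)$ yield state consensus if $\lim_{t\to\infty}\|x_i(t)-x_j(t)\|=0$ for all $i,j$ and all initial states; the system achieves asymptotic state consensus under the protocol if such gains exist. Let $y_i=x_{k_i}-x_i$ $(i\neq r)$ and $y=(y_i)_{i\ne r}$. Let $P_0\in\mathbb R^{N\times(N-1)}$ be the incidence matrix of $\mathcal T$, whose entry at vertex $v$ and edge $e$ is $1$ if $v$ is the starting point of $e$, $-1$ if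 $v$ is its end point, and $0$ otherwise. Let $\gamma_{ji}$ be the row vector with entries in $\{-1,0,1\}$ indexed by the edges of $\mathcal T$ whose entry at $e$ is $1$ if $e$ lies on the tree path from $r$ to $i$ but not on that from $r$ to $j$, $-1$ if $e$ lies on the tree path from $r$ to $j$ but not on that from $r$ to $i$, and $0$ otherwise (so that $x_j-x_i=(\gamma_{ji}\otimes I_n)y$). Let $\Gamma_i\in\mathbb R^{N\times(N-1)}$ have row $j$ equal to $\gamma_{ji}$ if $j\in N_i$ and to $0$ otherwise, and let $w_i=[w_{ij}]_{j\in V}$. Put $$A^*=I_{N-1}\otimes A,\qquad B^*=P_0^T\otimes B,\qquad C^*=\begin{bmatrix}\vdots\\ w_i\Gamma_i\otimes I_n\\ \vdots\end{bmatrix}_{i\in V},\qquad \mathbf K_D=\{\operatorname{diag}(K_i)_{i\in V}: K_i\in\mathbb R^{m\times n}\}.$$ The decentralized fixed modes of $(C^*,A^*,B^*)$ with respect to $\mathbf K_D$ are the elements of $\bigcap_{K\in\mathbf K_D}\sigma(A^*+B^*KC^*)\subset\mathbb C$, where $\sigma$ denotes the set of eigenvalues. Then: 1. For all gains $(K_i)$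 with $K_D=\operatorname{diag}(K_i)_{i\in V}$, the solutions on $[0,\infty)$ of $\dot y=(A^*+B^*K_DC^*)y$ are exactly the vectors $y=(x_{k_i}-x_i)_{i\ne r}$ formed from solutions $x$ of the closed-loop multi-agent system, and the gains $(K_i)$ yield state consensus if and only if $\dot y=(A^*+B^*K_DC^*)y$ is asymptotically stable. In particular, the multi-agent system achieves asymptotic state consensus under the protocol if and only if $(C^*,A^*,B^*)$ is stabilizable by a decentralized output feedback $u=K_Dz$, $z=C^*y$, with $K_D\in\mathbf K_D$. 2. The multi-agent system achieves asymptotic state consensus under the protocol if and only if no decentralized fixed mode of $(C^*,A^*,B^*)$ lies in $\{\lambda\in\sigma(A^*):\operatorname{Re}\lambda\ge 0\}$. -/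

import Mathlib

open Matrix Set Filter Topology
open scoped Kronecker

noncomputable section

namespace MASConsensus

/-- A weighted directed graph: `Adj j i` means that agent `j` transfers information to agent `i`
(that is, `j` is a neighbor of `i`), and `W i j` is the weight of that edge. -/
structure WeightedDigraph (V : Type*) extends Digraph V where
  W : Matrix V V ℝ
  nonneg : ∀ i j, 0 ≤ W i j
  pos_iff : ∀ i j, 0 < W i j ↔ Adj j i

/-- A directed spanning tree of `G`: each vertex `i` other than the root has exactly one parent,
`(parent i, i)` is an edge of `G`, and every vertex is reached from the root along such edges. -/
structure DirectedSpanningTree {V : Type*} (G : WeightedDigraph V) where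
  root : V
  parent : {v : V // v ≠ root} → V
  adj : ∀ i, G.Adj (parent i) i
  reach : ∀ v, Relation.ReflTransGen (fun a b => ∃ h : b ≠ root, parent ⟨b, h⟩ = a) root v

section Tree

variable {V : Type*} {G : WeightedDigraph V} (T : DirectedSpanningTree G)

/-- The fundamental edges `e_i = (parent i, i)`, indexed by the non-root vertices. -/
abbrev DirectedSpanningTree.Edge : Type _ := {v : V // v ≠ T.root}

/-- `(a, b)` is an edge of the tree. -/
def DirectedSpanningTree.TreeAdj (a b : V) : Prop := ∃ h : b ≠ T.root, T.parent ⟨b, h⟩ = a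

/-- The fundamental edge `e` lies on the tree path from the root to `i`: the end point of `e` is `i`
or an ancestor of `i`. -/
def DirectedSpanningTree.OnPath (e : T.Edge) (i : V) : Prop :=
  Relation.ReflTransGen T.TreeAdj e i

open Classical in
/-- The row vector `γ_{ji}`, which expresses `x_j - x_i = (x_k - x_i) - (x_k - x_j)` through
the fundamental edge states; here `k` is the root, and the edges common to the
two paths cancel. -/
def DirectedSpanningTree.gamma (j i : V) : T.Edge → ℝ := fun e =>
  (if T.OnPath e i then 1 else 0) - (if T.OnPath e j then 1 else 0)

open Classical in
/-- The information flow matrix `Γ_i`: its row `j` is `γ_{ji}` if `j` is a neighbor of `i`,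
and zero otherwise. -/
def DirectedSpanningTree.infoFlow (i : V) : Matrix V T.Edge ℝ :=
  Matrix.of fun j e => if G.Adj j i then T.gamma j i e else 0

/-- The incidence matrix `P₀` of the tree. -/
def DirectedSpanningTree.incidence [DecidableEq V] : Matrix V T.Edge ℝ :=
  Matrix.of fun v e => if v = T.parent e then 1 else if v = e then -1 else 0

/-- The vector of the fundamental edge states `y_i = x_{parent i} - x_i`. -/
def DirectedSpanningTree.edgeState {n : ℕ} (x : V → Fin n → ℝ) : T.Edge × Fin n → ℝ :=
  fun p => x (T.parent p.1) p.2 - x p.1 p.2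

variable [Fintype V] [DecidableEq V] {n m : ℕ}

/-- `A* = I ⊗ A`. -/
def DirectedSpanningTree.Astar (A : Matrix (Fin n) (Fin n) ℝ) :
    Matrix (T.Edge × Fin n) (T.Edge × Fin n) ℝ :=
  (1 : Matrix T.Edge T.Edge ℝ) ⊗ₖ A

/-- `B* = P₀ᵀ ⊗ B`. -/
def DirectedSpanningTree.Bstar (B : Matrix (Fin n) (Fin m) ℝ) :
    Matrix (T.Edge × Fin n) (V × Fin m) ℝ :=
  T.incidenceᵀ ⊗ₖ B

/-- `C*`, whose block row `i` is `C_i = (w_i Γ_i) ⊗ I_n`, with `w_i` the `i`-th row of `W`. -/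
def DirectedSpanningTree.Cstar (n : ℕ) : Matrix (V × Fin n) (T.Edge × Fin n) ℝ :=
  (Matrix.of fun i => G.W i ᵥ* T.infoFlow i) ⊗ₖ (1 : Matrix (Fin n) (Fin n) ℝ)

end Tree

section Systems

variable {ι υ ζ : Type*} [Fintype ι] [Fintype υ] [Fintype ζ]

/-- `y` solves `ẏ = M y` on `[0, ∞)`. -/
def IsTrajectory (M : Matrix ι ι ℝ) (y : ℝ → ι → ℝ) : Prop :=
  ∀ t, 0 ≤ t → HasDerivWithinAt y (M *ᵥ y t) (Ici 0) t

/-- The system `ẏ = M y` is asymptotically stable: the origin is Lyapunov stable and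
attracts every trajectory. (All norms on the finite-dimensional state space are equivalent.) -/
def IsAsymptoticallyStable (M : Matrix ι ι ℝ) : Prop :=
  (∀ ε > 0, ∃ δ > 0, ∀ y, IsTrajectory M y → ‖y 0‖ < δ → ∀ t, 0 ≤ t → ‖y t‖ < ε) ∧
  ∀ y, IsTrajectory M y → Tendsto y atTop (𝓝 0)

/-- The system `(C, A, B)` is stabilizable by static output feedback `u = K z` with a gain `K` in
the set `KK`. -/
def IsStabilizable (C : Matrix ζ ι ℝ) (A : Matrix ι ι ℝ) (B : Matrix ι υ ℝ)
    (KK : Set (Matrix υ ζ ℝ)) : Prop :=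
  ∃ K ∈ KK, IsAsymptoticallyStable (A + B * K * C)

/-- The decentralized fixed modes of `(C, A, B)` with respect to the set `KK` of gains: the
complex numbers which are eigenvalues of `A + B K C` for every `K ∈ KK`. -/
def fixedModes [DecidableEq ι] (C : Matrix ζ ι ℝ) (A : Matrix ι ι ℝ) (B : Matrix ι υ ℝ)
    (KK : Set (Matrix υ ζ ℝ)) : Set ℂ :=
  ⋂ K ∈ KK, spectrum ℂ ((A + B * K * C).map (algebraMap ℝ ℂ))

end Systems

section Consensus

variable {V : Type*} [Fintype V] [DecidableEq V] {n m : ℕ}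

/-- `K_D = diag(K_i)`. -/
def diagGain (K : V → Matrix (Fin m) (Fin n) ℝ) : Matrix (V × Fin m) (V × Fin n) ℝ :=
  Matrix.of fun p q => if p.1 = q.1 then K p.1 p.2 q.2 else 0

/-- The set of all block diagonal gains. -/
def diagGains (V : Type*) [DecidableEq V] (m n : ℕ) : Set (Matrix (V × Fin m) (V × Fin n) ℝ) :=
  Set.range fun K : V → Matrix (Fin m) (Fin n) ℝ => diagGain K

open Classical in
/-- The information `z_i = ∑_{j ∈ N_i} w_{ij} (x_j - x_i)` available to agent `i`. -/
def info (G : WeightedDigraph V) (x : V → Fin n → ℝ) (i : V) : Fin n → ℝ :=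
  ∑ j with G.Adj j i, G.W i j • (x j - x i)

/-- `x` solves, on `[0, ∞)`, the closed-loop system `ẋ_i = A x_i + B u_i`, `u_i = K_i z_i`. -/
def IsMASTrajectory (G : WeightedDigraph V) (A : Matrix (Fin n) (Fin n) ℝ)
    (B : Matrix (Fin n) (Fin m) ℝ) (K : V → Matrix (Fin m) (Fin n) ℝ)
    (x : V → ℝ → Fin n → ℝ) : Prop :=
  ∀ i, ∀ t, 0 ≤ t → HasDerivWithinAt (x i)
    (A *ᵥ x i t + B *ᵥ (K i *ᵥ info G (fun j => x j t) i)) (Ici 0) t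

/-- With the gains `K`, all agents reach consensus from all initial states. -/
def ReachesConsensus (G : WeightedDigraph V) (A : Matrix (Fin n) (Fin n) ℝ)
    (B : Matrix (Fin n) (Fin m) ℝ) (K : V → Matrix (Fin m) (Fin n) ℝ) : Prop :=
  ∀ x, IsMASTrajectory G A B K x →
    ∀ i j, Tendsto (fun t => ‖x i t - x j t‖) atTop (𝓝 0)

/-- The multi-agent system achieves asymptotic state consensus under the protocol `u_i = K_i z_i`:
suitable gains exist. -/
def AchievesConsensus (G : WeightedDigraph V) (A : Matrix (Fin n) (Fin n) ℝ)
    (B : Matrix (Fin n) (Fin m) ℝ) : Prop :=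
  ∃ K : V → Matrix (Fin m) (Fin n) ℝ, ReachesConsensus G A B K

end Consensus

end MASConsensus

end

/-! For every gain, the map from agent states to edge states intertwines the two closed-loop vector
fields. Because the tree is connected and acyclic, the map is also onto, with kernel the consensus
states. Together with uniqueness of solutions this identifies the edge trajectories with the
solutions of the transformed system. Consensus means that all edge states tend to zero. For a linear
system this is asymptotic stability, since attractivity forces a bounded flow.

For the fixed mode criterion, one direction holds because a stabilized matrix has no eigenvalue in
the closed right half plane. The converse does not go through a general theorem on decentralized
stabilization. All agents share `A` and `B`, so an unstable left eigenvector of `A` killed by `B`,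
placed on one edge, is a left eigenvector of the transformed system for every gain, and hence gives
a fixed mode (`mem_spectrum_of_uncontrollable`). Without unstable fixed modes the pair therefore
satisfies the Hautus condition, and explicit gains `K_i = s c_i Bᵀ X⁻¹` achieve consensus.

The matrix `X` solves a Lyapunov inequality, obtained by separating convex sets: a separating
functional would be a nonzero positive semidefinite matrix that contradicts the Hautus condition
(`exists_posDef`). The weights `c_i` come from the nonnegative inverse of the Laplacian grounded at
the root (`exists_weights`). The Lyapunov function is the sum of the quadratic forms of `X⁻¹` at
`x_i - x_root`. -/

namespace MASConsensus

/-! ### Linear differential equations and their flows -/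

section LinearODE

variable {E : Type*} [NormedAddCommGroup E] [NormedSpace ℝ E]

/-- Solutions of a linear differential equation on `[0, ∞)` are determined by their value at `0`. -/
theorem linear_trajectory_unique (F : E →L[ℝ] E) {y z : ℝ → E}
    (hy : ∀ t, 0 ≤ t → HasDerivWithinAt y (F (y t)) (Ici 0) t)
    (hz : ∀ t, 0 ≤ t → HasDerivWithinAt z (F (z t)) (Ici 0) t) (h0 : y 0 = z 0) :
    ∀ t, 0 ≤ t → y t = z t := by
  intro t ht
  have key := ODE_solution_unique (v := fun _ => F) (K := ‖F‖₊) (a := 0) (b := t)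
    (f := y) (g := z) (fun _ => F.lipschitz)
    (fun s hs => ((hy s hs.1).continuousWithinAt).mono Icc_subset_Ici_self)
    (fun s hs => (hy s hs.1).mono (Ici_subset_Ici.2 hs.1))
    (fun s hs => ((hz s hs.1).continuousWithinAt).mono Icc_subset_Ici_self)
    (fun s hs => (hz s hs.1).mono (Ici_subset_Ici.2 hs.1)) h0
  exact key ⟨ht, le_rfl⟩

theorem hasDerivAt_exp_smul_apply [CompleteSpace E] (F : E →L[ℝ] E) (x : E) (t : ℝ) :
    HasDerivAt (fun s : ℝ => NormedSpace.exp (s • F) x) (F (NormedSpace.exp (t • F) x)) t := by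
  have h := hasDerivAt_exp_smul_const' (𝕂 := ℝ) F t
  exact (h.clm_apply (hasDerivAt_const t x)).congr_deriv (by simp)

theorem linear_trajectory_eq_exp [CompleteSpace E] (F : E →L[ℝ] E) {y : ℝ → E}
    (hy : ∀ t, 0 ≤ t → HasDerivWithinAt y (F (y t)) (Ici 0) t) :
    ∀ t, 0 ≤ t → y t = NormedSpace.exp (t • F) (y 0) :=
  linear_trajectory_unique F hy
    (fun t _ => (hasDerivAt_exp_smul_apply F (y 0) t).hasDerivWithinAt) (by simp)

/-- If every solution of a linear differential equation tends to zero, its flow is bounded. -/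
theorem exists_bound_exp_smul [CompleteSpace E] (F : E →L[ℝ] E)
    (h : ∀ x, Tendsto (fun t : ℝ => NormedSpace.exp (t • F) x) atTop (𝓝 0)) :
    ∃ C : ℝ, ∀ t : ℝ, 0 ≤ t → ‖NormedSpace.exp (t • F)‖ ≤ C := by
  -- Each orbit is bounded, by convergence for large times and by compactness before; uniform
  -- boundedness makes the bound common to all initial values.
  obtain ⟨C, hC⟩ := banach_steinhaus
    (g := fun t : {t : ℝ // 0 ≤ t} => NormedSpace.exp ((t : ℝ) • F)) (fun x => by
      have hc : Continuous fun t : ℝ => NormedSpace.exp (t • F) x :=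
        continuous_iff_continuousAt.2 fun t => (hasDerivAt_exp_smul_apply F x t).continuousAt
      obtain ⟨T, hT⟩ := eventually_atTop.1
        ((h x).norm.eventually (gt_mem_nhds (show ‖(0 : E)‖ < 1 by simp)))
      obtain ⟨D, hD⟩ := (isCompact_Icc (a := (0 : ℝ)) (b := T)).exists_bound_of_continuousOn
        hc.continuousOn
      refine ⟨max 1 D, fun t => ?_⟩
      rcases le_total T t with ht | ht
      · exact (hT t ht).le.trans (le_max_left _ _)
      · exact (hD t ⟨t.2, ht⟩).trans (le_max_right _ _))
  exact ⟨C, fun t ht => hC ⟨t, ht⟩⟩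

end LinearODE

/-! ### Asymptotic stability and eigenvalues -/

section Stability

variable {ι : Type*} [Fintype ι]

/-- For linear systems attractivity implies Lyapunov stability. -/
theorem isAsymptoticallyStable_iff (M : Matrix ι ι ℝ) :
    IsAsymptoticallyStable M ↔ ∀ y, IsTrajectory M y → Tendsto y atTop (𝓝 0) := by
  refine ⟨fun h => h.2, fun h => ⟨?_, h⟩⟩
  let F : (ι → ℝ) →L[ℝ] (ι → ℝ) := LinearMap.toContinuousLinearMap M.mulVecLin
  obtain ⟨C, hC⟩ := exists_bound_exp_smul F fun x =>
    h _ fun t _ => (hasDerivAt_exp_smul_apply F x t).hasDerivWithinAt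
  intro ε hε
  have hC' : 0 < |C| + 1 := by positivity
  refine ⟨ε / (|C| + 1), by positivity, fun y hy h0 t ht => ?_⟩
  rw [linear_trajectory_eq_exp F hy t ht]
  calc _ ≤ ‖NormedSpace.exp (t • F)‖ * ‖y 0‖ := ContinuousLinearMap.le_opNorm _ _
    _ ≤ (|C| + 1) * ‖y 0‖ := by
        gcongr
        linarith [hC t ht, le_abs_self C]
    _ < ε := by rwa [lt_div_iff₀' hC'] at h0

theorem exists_mulVec_eq_smul_of_mem_spectrum [DecidableEq ι] {M : Matrix ι ι ℂ} {μ : ℂ}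
    (h : μ ∈ spectrum ℂ M) : ∃ v, v ≠ 0 ∧ M *ᵥ v = μ • v := by
  rw [spectrum.mem_iff, Matrix.isUnit_iff_isUnit_det, isUnit_iff_ne_zero, not_not] at h
  obtain ⟨v, hv, h⟩ := Matrix.exists_mulVec_eq_zero_iff.2 h
  refine ⟨v, hv, ?_⟩
  rw [sub_mulVec, Algebra.algebraMap_eq_smul_one, smul_mulVec, one_mulVec, sub_eq_zero] at h
  exact h.symm

theorem mem_spectrum_of_vecMul_eq_smul [DecidableEq ι] {M : Matrix ι ι ℂ} {μ : ℂ} {v : ι → ℂ}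
    (hv : v ≠ 0) (h : v ᵥ* M = μ • v) : μ ∈ spectrum ℂ M := by
  rw [spectrum.mem_iff, Matrix.isUnit_iff_isUnit_det, isUnit_iff_ne_zero, not_not]
  refine Matrix.exists_vecMul_eq_zero_iff.1 ⟨v, hv, ?_⟩
  rw [vecMul_sub, Algebra.algebraMap_eq_smul_one, vecMul_smul, vecMul_one, h, sub_self]

theorem isTrajectory_of_complex (M : Matrix ι ι ℝ) {μ : ℂ} {v : ι → ℂ}
    (h : M.map (algebraMap ℝ ℂ) *ᵥ v = μ • v) (L : ℂ →L[ℝ] ℝ) :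
    IsTrajectory M fun t i => L (Complex.exp (μ * t) * v i) := by
  intro t _
  refine HasDerivAt.hasDerivWithinAt (hasDerivAt_pi.2 fun i => ?_)
  have h1 : HasDerivAt (fun s : ℝ => μ * (s : ℂ)) μ t := by
    simpa using (Complex.ofRealCLM.hasDerivAt (x := t)).const_mul μ
  have h2 : HasDerivAt (fun s : ℝ => Complex.exp (μ * s) * v i)
      (Complex.exp (μ * t) * (μ • v) i) t :=
    (h1.cexp.mul_const (v i)).congr_deriv (by simp; ring)
  refine (L.hasFDerivAt.comp_hasDerivAt t h2).congr_deriv ?_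
  rw [← h]
  simp only [mulVec, dotProduct, Finset.mul_sum, map_sum]
  refine Finset.sum_congr rfl fun j _ => ?_
  have : Complex.exp (μ * t) * (M.map (algebraMap ℝ ℂ) i j * v j)
      = M i j • (Complex.exp (μ * t) * v j) := by
    simp [Complex.real_smul]; ring
  rw [this, map_smul, smul_eq_mul]

/-- The real and imaginary parts of `exp(μt) v` are real trajectories. If `Re μ ≥ 0`, a nonzero
coordinate of `exp(μt) v` keeps modulus at least that of `v`, so the two parts cannot both decay. -/
theorem IsAsymptoticallyStable.re_neg [DecidableEq ι] {M : Matrix ι ι ℝ}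
    (hM : IsAsymptoticallyStable M) {μ : ℂ} (hμ : μ ∈ spectrum ℂ (M.map (algebraMap ℝ ℂ))) :
    μ.re < 0 := by
  by_contra! hre
  obtain ⟨v, hv, h⟩ := exists_mulVec_eq_smul_of_mem_spectrum hμ
  obtain ⟨i, hi⟩ := Function.ne_iff.1 hv
  have hlim := fun L : ℂ →L[ℝ] ℝ =>
    tendsto_pi_nhds.1 (hM.2 _ (isTrajectory_of_complex M h L)) i
  have h1 := (hlim Complex.reCLM).abs.add (hlim Complex.imCLM).abs
  simp only [Complex.reCLM_apply, Complex.imCLM_apply, Pi.zero_apply, abs_zero, add_zero] at h1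
  refine hi (norm_le_zero_iff.1 (ge_of_tendsto h1 ?_))
  filter_upwards [eventually_ge_atTop 0] with t ht
  refine le_trans ?_ (Complex.norm_le_abs_re_add_abs_im _)
  rw [norm_mul, Complex.norm_exp]
  refine le_mul_of_one_le_left (norm_nonneg _) (Real.one_le_exp ?_)
  simpa using mul_nonneg hre ht

end Stability

theorem exists_isMASTrajectory {V : Type*} [Fintype V] {n m : ℕ} (G : WeightedDigraph V) (A : Matrix (Fin n) (Fin n) ℝ)
    (B : Matrix (Fin n) (Fin m) ℝ) (K : V → Matrix (Fin m) (Fin n) ℝ) (x₀ : V → Fin n → ℝ) :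
    ∃ x, IsMASTrajectory G A B K x ∧ (fun i => x i 0) = x₀ := by
  let F : (V → Fin n → ℝ) →ₗ[ℝ] (V → Fin n → ℝ) :=
    { toFun := fun x i => A *ᵥ x i + B *ᵥ (K i *ᵥ info G x i)
      map_add' := fun x y => by
        have h : ∀ i, info G (x + y) i = info G x i + info G y i := fun i => by
          simp only [info, ← Finset.sum_add_distrib, ← smul_add, Pi.add_apply]
          refine Finset.sum_congr rfl fun j _ => ?_
          congr 1
          abel
        ext1 i
        simp only [h, mulVec_add, Pi.add_apply]
        abel
      map_smul' := fun c x => by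
        have h : ∀ i, info G (c • x) i = c • info G x i := fun i => by
          simp only [info, Finset.smul_sum, Pi.smul_apply, ← smul_sub, smul_comm c]
        ext1 i
        simp only [h, mulVec_smul, Pi.smul_apply, RingHom.id_apply, smul_add] }
  refine ⟨fun i t => NormedSpace.exp (t • LinearMap.toContinuousLinearMap F) x₀ i, ?_, ?_⟩
  · intro i t _
    exact (hasDerivAt_pi.1
      (hasDerivAt_exp_smul_apply (LinearMap.toContinuousLinearMap F) x₀ t) i).hasDerivWithinAt
  · simp

/-! ### Edge states of the spanning tree -/

section Tree

variable {V : Type*} {G : WeightedDigraph V} (T : DirectedSpanningTree G)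

/-- Parents are unique, so a cycle through a vertex also passes through its parent. Following it
back reaches the root, which has no parent. -/
theorem DirectedSpanningTree.not_transGen_self (v : V) : ¬ Relation.TransGen T.TreeAdj v v := by
  induction T.reach v with
  | refl =>
    intro h
    obtain ⟨b, -, h, -⟩ := Relation.TransGen.tail'_iff.1 h
    exact h rfl
  | @tail a b _ hab ih =>
    intro h
    obtain ⟨c, hbc, hc, hca⟩ := Relation.TransGen.tail'_iff.1 h
    obtain ⟨hb, hba⟩ := hab
    have : c = a := hca.symm.trans hba
    subst this
    exact ih (Relation.TransGen.head' ⟨hb, hba⟩ hbc)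

theorem DirectedSpanningTree.parent_ne (e : T.Edge) : T.parent e ≠ e := fun h =>
  T.not_transGen_self e (.single ⟨e.2, h⟩)

theorem DirectedSpanningTree.not_onPath_root (e : T.Edge) : ¬ T.OnPath e T.root := by
  intro h
  rcases Relation.ReflTransGen.cases_tail h with h | ⟨c, -, h, -⟩
  · exact e.2 h.symm
  · exact h rfl

theorem DirectedSpanningTree.onPath_iff (e i : T.Edge) :
    T.OnPath e i ↔ e = i ∨ T.OnPath e (T.parent i) := by
  constructor
  · intro h
    rcases Relation.ReflTransGen.cases_tail h with h | ⟨c, hec, h, hc⟩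
    · exact Or.inl (Subtype.ext h.symm)
    · right
      subst hc
      exact hec
  · rintro (rfl | h)
    · exact .refl
    · exact Relation.ReflTransGen.tail h ⟨i.2, rfl⟩

theorem DirectedSpanningTree.not_onPath_parent (e : T.Edge) : ¬ T.OnPath e (T.parent e) := fun h =>
  T.not_transGen_self e (Relation.TransGen.tail' h ⟨e.2, rfl⟩)

/-- Induction on the vertices of a directed spanning tree, from the root towards the leaves. -/
theorem DirectedSpanningTree.induction {p : V → Prop} (root : p T.root)
    (step : ∀ e : T.Edge, p (T.parent e) → p e) (v : V) : p v := by
  induction T.reach v with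
  | refl => exact root
  | tail _ hab ih =>
    obtain ⟨hb, rfl⟩ := hab
    exact step ⟨_, hb⟩ ih

-- The root path of `i` is that of its parent extended by the edge `i`; sums along root paths are
-- computed by this recursion.
open Classical in
theorem DirectedSpanningTree.sum_onPath [Fintype T.Edge] (y : T.Edge → ℝ) (i : T.Edge) :
    ∑ e, (if T.OnPath e i then y e else 0)
      = y i + ∑ e, (if T.OnPath e (T.parent i) then y e else 0) := by
  have : ∀ e, (if T.OnPath e i then y e else 0)
      = (if e = i then y e else 0) + if T.OnPath e (T.parent i) then y e else 0 := by
    intro e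
    by_cases h : e = i
    · subst h
      rw [if_pos .refl, if_pos rfl, if_neg (T.not_onPath_parent e), add_zero]
    · simp [T.onPath_iff, h]
  simp [this, Finset.sum_add_distrib]

open Classical in
theorem DirectedSpanningTree.sum_onPath_sub [Fintype T.Edge] (x : V → ℝ) (v : V) :
    ∑ e : T.Edge, (if T.OnPath e v then x (T.parent e) - x e else 0) = x T.root - x v := by
  induction v using T.induction with
  | root => simp [T.not_onPath_root]
  | step i ih => rw [T.sum_onPath (fun e => x (T.parent e) - x e), ih]; ring

theorem DirectedSpanningTree.gamma_dotProduct [Fintype T.Edge] (x : V → ℝ) (j i : V) :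
    ∑ e : T.Edge, T.gamma j i e * (x (T.parent e) - x e) = x j - x i := by
  classical
  simp only [gamma, sub_mul, ite_mul, one_mul, zero_mul, Finset.sum_sub_distrib]
  rw [T.sum_onPath_sub, T.sum_onPath_sub]
  ring

variable [Fintype V] [DecidableEq V] {n m : ℕ}

theorem DirectedSpanningTree.Astar_mulVec_edgeState (A : Matrix (Fin n) (Fin n) ℝ)
    (x : V → Fin n → ℝ) :
    T.Astar A *ᵥ T.edgeState x = T.edgeState fun i => A *ᵥ x i := by
  ext ⟨e, a⟩
  simp only [Astar, mulVec, dotProduct, Fintype.sum_prod_type, kroneckerMap_apply, one_apply,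
    edgeState, ite_mul, one_mul, zero_mul, mul_sub, Finset.sum_sub_distrib]
  rw [Finset.sum_comm]
  conv_lhs => arg 2; rw [Finset.sum_comm]
  simp

theorem DirectedSpanningTree.Cstar_mulVec_edgeState (x : V → Fin n → ℝ) :
    T.Cstar n *ᵥ T.edgeState x = fun p => info G x p.1 p.2 := by
  ext ⟨i, a⟩
  simp only [Cstar, mulVec, dotProduct, Fintype.sum_prod_type, kroneckerMap_apply, one_apply,
    edgeState, of_apply, vecMul, infoFlow, info, Finset.sum_apply, Pi.smul_apply, Pi.sub_apply,
    smul_eq_mul, mul_ite, mul_one, mul_zero, ite_mul, zero_mul]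
  simp only [Finset.sum_ite_eq, Finset.mem_univ, if_true, Finset.sum_mul, Finset.sum_filter]
  rw [Finset.sum_comm]
  refine Finset.sum_congr rfl fun j _ => ?_
  split_ifs
  · rw [← T.gamma_dotProduct (fun v => x v a) j i, Finset.mul_sum]
    simp only [mul_assoc]
  · simp

theorem diagGain_mulVec (K : V → Matrix (Fin m) (Fin n) ℝ) (z : V → Fin n → ℝ) :
    diagGain K *ᵥ (fun p => z p.1 p.2) = fun p => (K p.1 *ᵥ z p.1) p.2 := by
  ext ⟨i, a⟩
  simp only [diagGain, mulVec, dotProduct, Fintype.sum_prod_type, of_apply, ite_mul, zero_mul]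
  rw [Finset.sum_comm]
  simp

theorem DirectedSpanningTree.sum_incidence_mul (u : V → ℝ) (e : T.Edge) :
    ∑ v, T.incidence v e * u v = u (T.parent e) - u e := by
  have : ∀ v, T.incidence v e * u v
      = (if v = T.parent e then u v else 0) - if v = (e : V) then u v else 0 := by
    intro v
    simp only [incidence, of_apply]
    by_cases h : v = T.parent e
    · subst h
      simp [T.parent_ne e]
    · rw [if_neg h, if_neg h]
      split_ifs <;> simp
  simp [this]

theorem DirectedSpanningTree.Bstar_mulVec (B : Matrix (Fin n) (Fin m) ℝ) (u : V → Fin m → ℝ) :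
    T.Bstar B *ᵥ (fun p => u p.1 p.2) = T.edgeState fun i => B *ᵥ u i := by
  ext ⟨e, a⟩
  have := T.sum_incidence_mul (fun v => (B *ᵥ u v) a) e
  simp only [edgeState]
  rw [← this]
  simp only [Bstar, mulVec, dotProduct, Fintype.sum_prod_type,
    kroneckerMap_apply, transpose_apply, mul_assoc, Finset.mul_sum]

/-- The closed-loop vector field of the agents, seen from the edges of the tree. -/
theorem DirectedSpanningTree.closedLoop_mulVec_edgeState (A : Matrix (Fin n) (Fin n) ℝ)
    (B : Matrix (Fin n) (Fin m) ℝ) (K : V → Matrix (Fin m) (Fin n) ℝ) (x : V → Fin n → ℝ) :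
    (T.Astar A + T.Bstar B * diagGain K * T.Cstar n) *ᵥ T.edgeState x
      = T.edgeState fun i => A *ᵥ x i + B *ᵥ (K i *ᵥ info G x i) := by
  rw [add_mulVec, ← mulVec_mulVec, ← mulVec_mulVec, T.Cstar_mulVec_edgeState,
    diagGain_mulVec K (info G x), T.Bstar_mulVec B fun i => K i *ᵥ info G x i,
    T.Astar_mulVec_edgeState]
  ext p
  simp only [edgeState, Pi.add_apply]
  ring

-- Summing `-y` along root paths gives a preimage with the root at zero. Surjectivity allows any
-- initial edge state to be lifted to the agents.
open Classical in
theorem DirectedSpanningTree.exists_edgeState_eq (y : T.Edge × Fin n → ℝ) :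
    ∃ x, T.edgeState x = y := by
  refine ⟨fun v a => -∑ e, (if T.OnPath e v then y (e, a) else 0), ?_⟩
  ext ⟨e, a⟩
  simp only [edgeState]
  rw [T.sum_onPath (fun e => y (e, a)) e]
  ring

theorem DirectedSpanningTree.isTrajectory_edgeState {A : Matrix (Fin n) (Fin n) ℝ}
    {B : Matrix (Fin n) (Fin m) ℝ} {K : V → Matrix (Fin m) (Fin n) ℝ} {x : V → ℝ → Fin n → ℝ}
    (hx : IsMASTrajectory G A B K x) :
    IsTrajectory (T.Astar A + T.Bstar B * diagGain K * T.Cstar n)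
      fun t => T.edgeState fun i => x i t := by
  intro t ht
  rw [T.closedLoop_mulVec_edgeState]
  refine hasDerivWithinAt_pi.2 fun p => ?_
  exact (hasDerivWithinAt_pi.1 (hx (T.parent p.1) t ht) p.2).sub
    (hasDerivWithinAt_pi.1 (hx p.1 t ht) p.2)

/-- The edge states of the solutions of the multi-agent system are exactly the solutions of the
transformed system. -/
theorem DirectedSpanningTree.isTrajectory_iff (A : Matrix (Fin n) (Fin n) ℝ)
    (B : Matrix (Fin n) (Fin m) ℝ) (K : V → Matrix (Fin m) (Fin n) ℝ)
    (y : ℝ → T.Edge × Fin n → ℝ) :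
    IsTrajectory (T.Astar A + T.Bstar B * diagGain K * T.Cstar n) y ↔
      ∃ x : V → ℝ → Fin n → ℝ, IsMASTrajectory G A B K x ∧
        ∀ t, 0 ≤ t → y t = T.edgeState (fun i => x i t) := by
  constructor
  · intro hy
    obtain ⟨x₀, hx₀⟩ := T.exists_edgeState_eq (y 0)
    obtain ⟨x, hx, h0⟩ := exists_isMASTrajectory G A B K x₀
    refine ⟨x, hx, linear_trajectory_unique (LinearMap.toContinuousLinearMap
      (T.Astar A + T.Bstar B * diagGain K * T.Cstar n).mulVecLin) hy
      (T.isTrajectory_edgeState hx) ?_⟩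
    rw [h0, hx₀]
  · rintro ⟨x, hx, hxy⟩ t ht
    rw [hxy t ht]
    exact (T.isTrajectory_edgeState hx t ht).congr (fun s hs => hxy s hs) (hxy t ht)

theorem DirectedSpanningTree.reachesConsensus_iff (A : Matrix (Fin n) (Fin n) ℝ)
    (B : Matrix (Fin n) (Fin m) ℝ) (K : V → Matrix (Fin m) (Fin n) ℝ) :
    ReachesConsensus G A B K ↔
      IsAsymptoticallyStable (T.Astar A + T.Bstar B * diagGain K * T.Cstar n) := by
  rw [isAsymptoticallyStable_iff]
  constructor
  · intro h y hy
    obtain ⟨x, hx, hxy⟩ := (T.isTrajectory_iff A B K y).1 hy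
    refine tendsto_pi_nhds.2 fun p => ?_
    have h1 := tendsto_pi_nhds.1
      (tendsto_zero_iff_norm_tendsto_zero.2 (h x hx (T.parent p.1) p.1)) p.2
    refine h1.congr' ?_
    filter_upwards [eventually_ge_atTop 0] with t ht
    rw [hxy t ht]
    rfl
  · intro h x hx i j
    have hy := tendsto_pi_nhds.1 (h _ (T.isTrajectory_edgeState hx))
    -- Differences to the root telescope along tree edges.
    have key : ∀ v, Tendsto (fun t => x T.root t - x v t) atTop (𝓝 0) := by
      intro v
      induction v using T.induction with
      | root => simp
      | step e ih =>
        have h1 : Tendsto (fun t => x (T.parent e) t - x e t) atTop (𝓝 0) :=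
          tendsto_pi_nhds.2 fun a => hy (e, a)
        simpa using ih.add h1
    refine tendsto_zero_iff_norm_tendsto_zero.1 ?_
    simpa using (key j).sub (key i)

end Tree

/-! ### Hautus condition and the dual certificate -/

section LinearMatrixInequality

variable {ι κ : Type*} [Fintype ι]

/-- The Popov–Belevitch–Hautus condition for stabilizability: no left eigenvector of `A` for an
eigenvalue in the closed right half plane is annihilated by `B`. -/
def IsHautusStabilizable (A : Matrix ι ι ℝ) (B : Matrix ι κ ℝ) : Prop :=
  ∀ (μ : ℂ) (v : ι → ℂ), 0 ≤ μ.re → v ᵥ* A.map (algebraMap ℝ ℂ) = μ • v →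
    v ᵥ* B.map (algebraMap ℝ ℂ) = 0 → v = 0

/-- A functional vanishing on the common kernel of the rows of `Z` is a combination of those rows.
-/
theorem exists_eq_mul_of_ker_le {Z W : Matrix ι ι ℝ} (h : ∀ u, Z *ᵥ u = 0 → W *ᵥ u = 0) :
    ∃ M : Matrix ι ι ℝ, W = M * Z := by
  classical
  have key : ∀ i, ∃ c : ι → ℝ, ∑ j, c j • (LinearMap.proj j ∘ₗ Z.mulVecLin)
      = LinearMap.proj i ∘ₗ W.mulVecLin := fun i =>
    (Submodule.mem_span_range_iff_exists_fun ℝ).1 (mem_span_of_iInf_ker_le_ker fun u hu => by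
      have hu' : Z *ᵥ u = 0 := by
        ext j
        simpa using (Submodule.mem_iInf _).1 hu j
      simpa using congrFun (h u hu') i)
  choose c hc using key
  refine ⟨of c, ?_⟩
  ext i k
  have := LinearMap.congr_fun (hc i) (Pi.single k 1)
  simp only [LinearMap.coe_sum, Finset.sum_apply, LinearMap.smul_apply, LinearMap.comp_apply,
    mulVecLin_apply, LinearMap.proj_apply, mulVec_single_one, col_apply, smul_eq_mul] at this
  rw [← this, mul_apply]
  rfl

theorem re_vecMul_map (v : ι → ℂ) (M : Matrix ι κ ℝ) (j : κ) :
    ((v ᵥ* M.map (algebraMap ℝ ℂ)) j).re = ((fun i => (v i).re) ᵥ* M) j := by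
  simp [vecMul, dotProduct]

theorem im_vecMul_map (v : ι → ℂ) (M : Matrix ι κ ℝ) (j : κ) :
    ((v ᵥ* M.map (algebraMap ℝ ℂ)) j).im = ((fun i => (v i).im) ᵥ* M) j := by
  simp [vecMul, dotProduct]

/-- Write `u = a + ib` and add the hypothesis `hA` at `a` and at `b`. The terms in `Im μ` cancel by
symmetry of `Z`, leaving `Re μ` times `a·Za + b·Zb`, which is positive because `uZ ≠ 0`. -/
theorem re_nonneg_of_vecMul_eq_smul {A Z : Matrix ι ι ℝ} (hZ : Z.PosSemidef)
    (hA : ∀ v, 0 ≤ (A *ᵥ v) ⬝ᵥ (Z *ᵥ v)) {μ : ℂ} {u : ι → ℂ}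
    (hu : u ᵥ* Z.map (algebraMap ℝ ℂ) ≠ 0)
    (h : (u ᵥ* Z.map (algebraMap ℝ ℂ)) ᵥ* A.map (algebraMap ℝ ℂ)
      = μ • (u ᵥ* Z.map (algebraMap ℝ ℂ))) : 0 ≤ μ.re := by
  set v := u ᵥ* Z.map (algebraMap ℝ ℂ) with hv
  set a : ι → ℝ := fun i => (u i).re
  set b : ι → ℝ := fun i => (u i).im
  have hZT : Zᵀ = Z :=
    (conjTranspose_eq_transpose_of_trivial Z).symm.trans hZ.1
  have hva : (fun i => (v i).re) = Z *ᵥ a := by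
    ext i
    rw [hv, re_vecMul_map, ← mulVec_transpose, hZT]
  have hvb : (fun i => (v i).im) = Z *ᵥ b := by
    ext i
    rw [hv, im_vecMul_map, ← mulVec_transpose, hZT]
  have h1 : (Z *ᵥ a) ᵥ* A = μ.re • (Z *ᵥ a) - μ.im • (Z *ᵥ b) := by
    rw [← hva, ← hvb]
    ext i
    rw [← re_vecMul_map, h]
    simp
  have h2 : (Z *ᵥ b) ᵥ* A = μ.re • (Z *ᵥ b) + μ.im • (Z *ᵥ a) := by
    rw [← hva, ← hvb]
    ext i
    rw [← im_vecMul_map, h]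
    simp
  have hsym : b ⬝ᵥ (Z *ᵥ a) = a ⬝ᵥ (Z *ᵥ b) := by
    rw [dotProduct_mulVec, ← mulVec_transpose, hZT, dotProduct_comm]
  have ha := hA a
  have hb := hA b
  rw [dotProduct_comm, dotProduct_mulVec, h1, dotProduct_comm, dotProduct_sub, dotProduct_smul,
    dotProduct_smul, smul_eq_mul, smul_eq_mul] at ha
  rw [dotProduct_comm, dotProduct_mulVec, h2, dotProduct_comm, dotProduct_add, dotProduct_smul,
    dotProduct_smul, smul_eq_mul, smul_eq_mul, hsym] at hb
  have hqa : 0 ≤ a ⬝ᵥ (Z *ᵥ a) := by simpa using hZ.dotProduct_mulVec_nonneg a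
  have hqb : 0 ≤ b ⬝ᵥ (Z *ᵥ b) := by simpa using hZ.dotProduct_mulVec_nonneg b
  have hpos : 0 < a ⬝ᵥ (Z *ᵥ a) + b ⬝ᵥ (Z *ᵥ b) := by
    refine lt_of_le_of_ne (by positivity) fun h0 => hu ?_
    have ha0 : Z *ᵥ a = 0 := (hZ.dotProduct_mulVec_zero_iff a).1 (by rw [star_trivial]; linarith)
    have hb0 : Z *ᵥ b = 0 := (hZ.dotProduct_mulVec_zero_iff b).1 (by rw [star_trivial]; linarith)
    ext i
    exact Complex.ext (congrFun (hva.trans ha0) i) (congrFun (hvb.trans hb0) i)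
  exact nonneg_of_mul_nonneg_left (by linarith) hpos

/-- The matrix `AᵀZ + ZA` is positive semidefinite and its form vanishes on `ker Z`, so `ZA` kills
`ker Z` and `ZA = MZ`. Hence the complex row space of `Z` is invariant under `A`. If it were nonzero
it would contain a left eigenvector, unstable by `hA` and killed by `B`. -/
theorem IsHautusStabilizable.eq_zero_of_dual {A Z : Matrix ι ι ℝ} {B : Matrix ι κ ℝ}
    (hAB : IsHautusStabilizable A B) (hZ : Z.PosSemidef)
    (hA : ∀ v, 0 ≤ (A *ᵥ v) ⬝ᵥ (Z *ᵥ v)) (hB : Z * B = 0) : Z = 0 := by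
  classical
  by_contra hne
  have hZT : Zᵀ = Z :=
    (conjTranspose_eq_transpose_of_trivial Z).symm.trans hZ.1
  have hquad : ∀ u, u ⬝ᵥ ((Aᵀ * Z + Z * A) *ᵥ u) = 2 * ((A *ᵥ u) ⬝ᵥ (Z *ᵥ u)) := fun u => by
    rw [add_mulVec, dotProduct_add, ← mulVec_mulVec, ← mulVec_mulVec, dotProduct_mulVec,
      vecMul_transpose, dotProduct_mulVec u Z, ← mulVec_transpose, hZT,
      dotProduct_comm (Z *ᵥ u)]
    ring
  have hR : (Aᵀ * Z + Z * A).PosSemidef := by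
    refine .of_dotProduct_mulVec_nonneg ?_ fun u => ?_
    · rw [IsHermitian, conjTranspose_eq_transpose_of_trivial, transpose_add, transpose_mul,
        transpose_mul, transpose_transpose, hZT, add_comm]
    · rw [star_trivial, hquad]
      linarith [hA u]
  obtain ⟨M, hM⟩ := exists_eq_mul_of_ker_le (Z := Z) (W := Z * A) fun u hu => by
    have h0 : (Aᵀ * Z + Z * A) *ᵥ u = 0 := (hR.dotProduct_mulVec_zero_iff u).1 (by
      rw [star_trivial, hquad, hu, dotProduct_zero, mul_zero])
    rwa [add_mulVec, ← mulVec_mulVec, hu, mulVec_zero, zero_add] at h0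
  let c : ℝ →+* ℂ := algebraMap ℝ ℂ
  let W := LinearMap.range (Z.map c).vecMulLinear
  have hinv : ∀ v ∈ W, (A.map c).vecMulLinear v ∈ W := by
    rintro _ ⟨u, rfl⟩
    refine ⟨u ᵥ* M.map c, ?_⟩
    simp only [vecMulLinear_apply, vecMul_vecMul]
    rw [← Matrix.map_mul, ← Matrix.map_mul, hM]
  have : Nontrivial W := by
    rw [Submodule.nontrivial_iff_ne_bot]
    intro hbot
    refine hne ?_
    ext i j
    have h0 := LinearMap.congr_fun (LinearMap.range_eq_bot.1 hbot) (Pi.single i 1)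
    have h1 := congrFun h0 j
    simpa [c] using h1
  obtain ⟨μ, hμ⟩ := Module.End.exists_eigenvalue ((A.map c).vecMulLinear.restrict hinv)
  obtain ⟨⟨v, u, rfl⟩, hv⟩ := hμ.exists_hasEigenvector
  have hv0 : u ᵥ* Z.map c ≠ 0 := fun h => hv.2 (Subtype.ext h)
  have heig : (u ᵥ* Z.map c) ᵥ* A.map c = μ • (u ᵥ* Z.map c) :=
    congrArg Subtype.val hv.apply_eq_smul
  refine hv0 (hAB μ _ (re_nonneg_of_vecMul_eq_smul hZ hA hv0 heig) heig ?_)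
  rw [vecMul_vecMul]
  change u ᵥ* (Z.map c * B.map c) = 0
  rw [← Matrix.map_mul, hB, Matrix.map_zero _ (map_zero c), vecMul_zero]

end LinearMatrixInequality

/-! ### Solving the Lyapunov inequality by separation -/

section LinearMatrixInequality

variable {ι κ : Type*} [Fintype ι] [Fintype κ]

theorem isOpen_setOf_forall_dotProduct_mulVec_neg :
    IsOpen {M : Matrix ι ι ℝ | ∀ u, u ≠ 0 → u ⬝ᵥ (M *ᵥ u) < 0} := by
  -- By homogeneity the unit sphere suffices, and its compactness gives openness.
  have heq : {M : Matrix ι ι ℝ | ∀ u, u ≠ 0 → u ⬝ᵥ (M *ᵥ u) < 0}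
      = {M | ∀ u ∈ Metric.sphere (0 : ι → ℝ) 1, u ⬝ᵥ (M *ᵥ u) < 0} := by
    ext M
    refine ⟨fun h u hu => h u (ne_zero_of_mem_unit_sphere ⟨u, hu⟩), fun h u hu => ?_⟩
    have hn : 0 < ‖u‖ := norm_pos_iff.2 hu
    have h1 := h (‖u‖⁻¹ • u) (by simp [norm_smul, hn.ne'])
    rw [mulVec_smul, dotProduct_smul, smul_dotProduct, smul_smul, smul_eq_mul] at h1
    exact neg_of_mul_neg_right h1 (by positivity)
  rw [heq, isOpen_iff_eventually]
  intro M hM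
  refine (isCompact_sphere (0 : ι → ℝ) 1).eventually_forall_of_forall_eventually fun u hu => ?_
  have hc : Continuous fun z : Matrix ι ι ℝ × (ι → ℝ) => z.2 ⬝ᵥ (z.1 *ᵥ z.2) := by fun_prop
  exact hc.continuousAt.eventually (gt_mem_nhds (hM u hu))

theorem convex_setOf_forall_dotProduct_mulVec_neg :
    Convex ℝ {M : Matrix ι ι ℝ | ∀ u, u ≠ 0 → u ⬝ᵥ (M *ᵥ u) < 0} := by
  refine convex_iff_forall_pos.2 fun M hM N hN a b ha hb _ u hu => ?_
  rw [add_mulVec, dotProduct_add, smul_mulVec, smul_mulVec, dotProduct_smul, dotProduct_smul,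
    smul_eq_mul, smul_eq_mul]
  nlinarith [mul_neg_of_pos_of_neg ha (hM u hu), mul_neg_of_pos_of_neg hb (hN u hu)]

theorem convex_setOf_lyapunov (A C : Matrix ι ι ℝ) :
    Convex ℝ {M | ∃ (X : Matrix ι ι ℝ) (s : ℝ), X.PosDef ∧ 0 ≤ s ∧
      M = A * X + X * Aᵀ - s • C} := by
  refine convex_iff_forall_pos.2 ?_
  rintro _ ⟨X, s, hX, hs, rfl⟩ _ ⟨Y, t, hY, ht, rfl⟩ a b ha hb _
  refine ⟨a • X + b • Y, a * s + b * t, (hX.smul ha).add (hY.smul hb), by positivity, ?_⟩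
  simp only [mul_add, add_mul, Matrix.mul_smul, Matrix.smul_mul, smul_sub, smul_add, add_smul,
    mul_smul]
  abel

/-- The symmetric matrix representing a linear functional on symmetric matrices. -/
def dualMatrix [DecidableEq ι] (f : Matrix ι ι ℝ →ₗ[ℝ] ℝ) : Matrix ι ι ℝ :=
  of fun i j => f (single i j 1 + single j i 1)

theorem map_vecMulVec [DecidableEq ι] (f : Matrix ι ι ℝ →ₗ[ℝ] ℝ) (u v : ι → ℝ) :
    f (vecMulVec u v) = ∑ i, ∑ j, u i * v j * f (single i j 1) := by
  conv_lhs => rw [matrix_eq_sum_single (vecMulVec u v)]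
  simp only [map_sum]
  refine Finset.sum_congr rfl fun i _ => Finset.sum_congr rfl fun j _ => ?_
  rw [vecMulVec_apply, ← smul_eq_mul (u i * v j), ← map_smul, smul_single, smul_eq_mul, mul_one]

/-- On symmetric `M` this amounts to `f M = ½ tr(ZM)` with `Z` the dual matrix, so the sign
conditions from separation become conditions on the form of `Z`. -/
theorem dotProduct_dualMatrix_mulVec [DecidableEq ι] (f : Matrix ι ι ℝ →ₗ[ℝ] ℝ) (u v : ι → ℝ) :
    u ⬝ᵥ (dualMatrix f *ᵥ v) = f (vecMulVec u v + vecMulVec v u) := by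
  rw [map_add, map_vecMulVec, map_vecMulVec]
  conv_rhs => arg 2; rw [Finset.sum_comm]
  simp only [dotProduct, mulVec, dualMatrix, of_apply, map_add, ← Finset.sum_add_distrib,
    Finset.mul_sum]
  refine Finset.sum_congr rfl fun i _ => Finset.sum_congr rfl fun j _ => ?_
  ring

theorem mul_transpose_eq_sum_vecMulVec {ι κ : Type*} [Fintype κ] (B C : Matrix ι κ ℝ) :
    B * Cᵀ = ∑ k, vecMulVec (B.col k) (C.col k) := by
  ext i j
  simp [mul_apply, Matrix.sum_apply, vecMulVec_apply]

theorem map_mul_transpose_self [DecidableEq ι] (f : Matrix ι ι ℝ →ₗ[ℝ] ℝ) (B : Matrix ι κ ℝ) :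
    2 * f (B * Bᵀ) = ∑ k, B.col k ⬝ᵥ (dualMatrix f *ᵥ B.col k) := by
  rw [mul_transpose_eq_sum_vecMulVec]
  simp only [dotProduct_dualMatrix_mulVec, map_add, map_sum, two_mul, Finset.sum_add_distrib]

theorem map_add_transpose [DecidableEq ι] (f : Matrix ι ι ℝ →ₗ[ℝ] ℝ) (A : Matrix ι ι ℝ) :
    f (A + Aᵀ) = ∑ k, A.col k ⬝ᵥ (dualMatrix f *ᵥ Pi.single k 1) := by
  have h1 := mul_transpose_eq_sum_vecMulVec A 1
  have h2 := mul_transpose_eq_sum_vecMulVec 1 A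
  rw [transpose_one, mul_one] at h1
  rw [one_mul] at h2
  rw [map_add, h2]
  nth_rewrite 1 [h1]
  simp only [dotProduct_dualMatrix_mulVec, map_add, map_sum, Finset.sum_add_distrib]
  congr! 5 with k <;> (ext i; simp [one_apply, Pi.single_apply])

/-- A pair satisfying the Hautus condition for stabilizability admits a strict solution of the
Lyapunov-type linear matrix inequality which yields a stabilizing gain. -/
theorem IsHautusStabilizable.exists_posDef {A : Matrix ι ι ℝ} {B : Matrix ι κ ℝ}
    (hAB : IsHautusStabilizable A B) :
    ∃ (X : Matrix ι ι ℝ) (s α : ℝ), X.PosDef ∧ 0 ≤ s ∧ 0 < α ∧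
      ∀ u, u ⬝ᵥ ((A * X + X * Aᵀ - s • (B * Bᵀ) + α • X) *ᵥ u) ≤ 0 := by
  classical
  by_cases hdisj : Disjoint {M : Matrix ι ι ℝ | ∀ u, u ≠ 0 → u ⬝ᵥ (M *ᵥ u) < 0}
      {M | ∃ (X : Matrix ι ι ℝ) (s : ℝ), X.PosDef ∧ 0 ≤ s ∧ M = A * X + X * Aᵀ - s • (B * Bᵀ)}
  · exfalso
    obtain ⟨f, c, hneg, hlyap⟩ := geometric_hahn_banach_open
      convex_setOf_forall_dotProduct_mulVec_neg isOpen_setOf_forall_dotProduct_mulVec_neg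
      (convex_setOf_lyapunov A (B * Bᵀ)) hdisj
    let g : Matrix ι ι ℝ →ₗ[ℝ] ℝ := f
    have hnegdef : ∀ (v : ι → ℝ) (t : ℝ), 0 ≤ t →
        -(t • vecMulVec v v + 1) ∈ {M : Matrix ι ι ℝ | ∀ u, u ≠ 0 → u ⬝ᵥ (M *ᵥ u) < 0} := by
      intro v t ht u hu
      have h1 : 0 < u ⬝ᵥ u := by simpa using (dotProduct_star_self_pos_iff (v := u)).2 hu
      rw [neg_mulVec, add_mulVec, smul_mulVec, one_mulVec, dotProduct_neg, dotProduct_add,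
        dotProduct_smul, smul_eq_mul, vecMulVec_mulVec, dotProduct_smul, dotProduct_comm v u]
      simp only [MulOpposite.smul_eq_mul_unop, MulOpposite.unop_op]
      nlinarith [mul_nonneg ht (mul_self_nonneg (u ⬝ᵥ v))]
    have hposdef : ∀ (v : ι → ℝ) (t : ℝ), 0 ≤ t →
        (t • vecMulVec v v + (1 : Matrix ι ι ℝ)).PosDef := fun v t ht =>
      PosDef.posSemidef_add (PosSemidef.smul (by simpa using posSemidef_vecMulVec_self_star v) ht)
        PosDef.one
    -- An affine function bounded below on a ray has nonnegative slope. Applied along rays in the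
    -- two separated sets, this yields the sign conditions on the dual matrix.
    have hslope : ∀ p q : ℝ, (∀ t : ℝ, 0 ≤ t → c ≤ p + t * q) → 0 ≤ q := by
      intro p q h
      by_contra! hq
      obtain ⟨k, hk⟩ := exists_nat_gt ((c - p) / q)
      have h1 := h k k.cast_nonneg
      rw [div_lt_iff_of_neg hq] at hk
      linarith
    have hlyap' : ∀ (X : Matrix ι ι ℝ) (s : ℝ), X.PosDef → 0 ≤ s →
        c ≤ g (A * X + X * Aᵀ) - s * g (B * Bᵀ) := fun X s hX hs => by
      have := hlyap _ ⟨X, s, hX, hs, rfl⟩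
      rwa [map_sub, map_smul, smul_eq_mul] at this
    have hsq : ∀ v, 0 ≤ v ⬝ᵥ (dualMatrix g *ᵥ v) := fun v => by
      rw [dotProduct_dualMatrix_mulVec, map_add, ← two_mul]
      -- The offset `2 * c` turns the lower bound `-c` from `hneg` into the bound `c` that `hslope`
      -- expects.
      refine mul_nonneg zero_le_two (hslope (g 1 + 2 * c) _ fun t ht => ?_)
      have h1 := hneg _ (hnegdef v t ht)
      rw [map_neg, map_add, map_smul, smul_eq_mul] at h1
      change -(t * g (vecMulVec v v) + g 1) < c at h1
      linarith
    have hZ : (dualMatrix g).PosSemidef := by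
      refine .of_dotProduct_mulVec_nonneg ?_ fun v => by simpa using hsq v
      ext i j
      simp [dualMatrix, add_comm]
    have hA : ∀ v, 0 ≤ (A *ᵥ v) ⬝ᵥ (dualMatrix g *ᵥ v) := fun v => by
      refine hslope (g (A + Aᵀ)) _ fun t ht => ?_
      have h1 := hlyap' _ 0 (hposdef v t ht) le_rfl
      rw [zero_mul, sub_zero] at h1
      rw [dotProduct_dualMatrix_mulVec, ← smul_eq_mul t, ← map_smul, ← map_add]
      convert h1 using 2
      rw [mul_add, add_mul, Matrix.mul_smul, Matrix.smul_mul, mul_one, one_mul, mul_vecMulVec,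
        vecMulVec_mul, vecMul_transpose, smul_add]
      abel
    have hBB : g (B * Bᵀ) ≤ 0 := by
      refine neg_nonneg.1 (hslope (g (A + Aᵀ)) _ fun t ht => ?_)
      have h1 := hlyap' 1 t PosDef.one ht
      rw [mul_one, one_mul] at h1
      linarith
    have hB : dualMatrix g * B = 0 := by
      have h1 := map_mul_transpose_self g B
      have h2 := (Finset.sum_eq_zero_iff_of_nonneg fun k _ => hsq (B.col k)).1
        (le_antisymm (by linarith) (Finset.sum_nonneg fun k _ => hsq (B.col k)))
      ext i k
      exact congrFun ((hZ.dotProduct_mulVec_zero_iff (B.col k)).1 (by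
        simpa using h2 k (Finset.mem_univ k))) i
    have hZ0 := hAB.eq_zero_of_dual hZ hA hB
    -- With a zero dual matrix the functional vanishes on symmetric matrices, so separation would
    -- give both `0 < c` and `c ≤ 0`.
    have hone : g 1 = 0 := by
      have h1 := map_mul_transpose_self g (1 : Matrix ι ι ℝ)
      rw [hZ0] at h1
      simpa using h1
    have h1 := hneg _ (hnegdef 0 0 le_rfl)
    have h2 := hlyap' 1 0 PosDef.one le_rfl
    rw [mul_one, one_mul, map_add_transpose, hZ0] at h2
    rw [map_neg, zero_smul, zero_add] at h1
    change -g 1 < c at h1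
    simp only [zero_mulVec, dotProduct_zero, Finset.sum_const_zero] at h2
    linarith
  · obtain ⟨_, hM, X, s, hX, hs, rfl⟩ := Set.not_disjoint_iff.1 hdisj
    -- Strict negativity is an open condition, so it leaves room for a small multiple of `X`, the
    -- decay rate.
    have hcont : Continuous fun α : ℝ => A * X + X * Aᵀ - s • (B * Bᵀ) + α • X := by fun_prop
    have hnhds := hcont.continuousAt.preimage_mem_nhds (x := 0)
      (isOpen_setOf_forall_dotProduct_mulVec_neg.mem_nhds (by simpa using hM))
    obtain ⟨α, hα, hpos⟩ := Filter.Eventually.exists (f := 𝓝[>] (0 : ℝ))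
      (Filter.Eventually.and (nhdsWithin_le_nhds hnhds) self_mem_nhdsWithin)
    refine ⟨X, s, α, hX, hs, hpos, fun u => ?_⟩
    by_cases hu : u = 0
    · simp [hu]
    · exact (hα u hu).le

end LinearMatrixInequality

/-! ### The grounded Laplacian and the agent weights -/

section GroundedLaplacian

variable {V : Type*} [Fintype V] {G : WeightedDigraph V}

theorem WeightedDigraph.W_eq_zero {V : Type*} {G : WeightedDigraph V} {i j : V} (h : ¬ G.Adj j i) : G.W i j = 0 :=
  le_antisymm (not_lt.1 fun h' => h ((G.pos_iff i j).1 h')) (G.nonneg i j)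

theorem info_eq_sum {n : ℕ} (G : WeightedDigraph V) (x : V → Fin n → ℝ) (i : V) :
    info G x i = ∑ j, G.W i j • (x j - x i) := by
  classical
  rw [info, Finset.sum_filter]
  refine Finset.sum_congr rfl fun j _ => ?_
  split_ifs with h
  · rfl
  · rw [G.W_eq_zero h, zero_smul]

variable (T : DirectedSpanningTree G)

/-- Minimum principle for the Laplacian of `G`, grounded at the root of a spanning tree. -/
theorem DirectedSpanningTree.nonneg_of_laplacian_nonneg {v : V → ℝ} (hr : 0 ≤ v T.root)
    (h : ∀ i, i ≠ T.root → 0 ≤ ∑ j, G.W i j * (v i - v j)) (i : V) : 0 ≤ v i := by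
  have : Nonempty V := ⟨T.root⟩
  obtain ⟨i₀, hi₀⟩ := Finite.exists_min v
  refine le_trans ?_ (hi₀ i)
  by_contra! hneg
  -- At a minimum every term of the Laplacian sum is nonpositive, hence zero. The parent is then
  -- also a minimum, and so on up to the root, where `v` is nonnegative.
  have key : ∀ k, v k ≠ v i₀ := fun k => by
    induction k using T.induction with
    | root => exact (hneg.trans_le hr).ne'
    | step e ih =>
      intro he
      have hterm : ∀ j ∈ Finset.univ, G.W e j * (v e - v j) ≤ 0 := fun j _ =>
        mul_nonpos_of_nonneg_of_nonpos (G.nonneg _ _) (by linarith [hi₀ j])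
      have h0 := (Finset.sum_eq_zero_iff_of_nonpos hterm).1
        (le_antisymm (Finset.sum_nonpos hterm) (h e e.2)) (T.parent e) (Finset.mem_univ _)
      have hw : G.W e (T.parent e) ≠ 0 := ((G.pos_iff _ _).2 (T.adj e)).ne'
      exact ih (by linarith [(mul_eq_zero.1 h0).resolve_left hw])
  exact key i₀ rfl

variable [DecidableEq V]

/-- The Laplacian of `G`, with the row of the root replaced by that of the identity. -/
def DirectedSpanningTree.groundedLaplacian : Matrix V V ℝ :=
  of fun i j => if i = T.root then (if j = T.root then 1 else 0)
    else (if j = i then ∑ k, G.W i k else 0) - G.W i j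

theorem DirectedSpanningTree.groundedLaplacian_mulVec_root (v : V → ℝ) :
    (T.groundedLaplacian *ᵥ v) T.root = v T.root := by
  simp [groundedLaplacian, mulVec, dotProduct]

theorem DirectedSpanningTree.groundedLaplacian_mulVec (v : V → ℝ) {i : V} (hi : i ≠ T.root) :
    (T.groundedLaplacian *ᵥ v) i = ∑ j, G.W i j * (v i - v j) := by
  simp [groundedLaplacian, mulVec, dotProduct, hi, sub_mul, mul_sub, ← Finset.sum_mul]

theorem DirectedSpanningTree.nonneg_of_groundedLaplacian_mulVec_nonneg {v : V → ℝ}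
    (h : ∀ i, 0 ≤ (T.groundedLaplacian *ᵥ v) i) (i : V) : 0 ≤ v i :=
  T.nonneg_of_laplacian_nonneg (T.groundedLaplacian_mulVec_root v ▸ h T.root)
    (fun j hj => T.groundedLaplacian_mulVec v hj ▸ h j) i

/-- By the minimum principle the matrix is injective with entrywise nonnegative inverse; `c`
consists of the column sums of that inverse. -/
theorem DirectedSpanningTree.exists_vecMul_groundedLaplacian_eq_one :
    ∃ c : V → ℝ, (∀ i, 0 ≤ c i) ∧ c ᵥ* T.groundedLaplacian = 1 := by
  have hdet : IsUnit T.groundedLaplacian.det := by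
    rw [isUnit_iff_ne_zero]
    intro h0
    obtain ⟨v, hv, h⟩ := Matrix.exists_mulVec_eq_zero_iff.2 h0
    refine hv (funext fun i => le_antisymm ?_ ?_)
    · have := T.nonneg_of_groundedLaplacian_mulVec_nonneg (v := -v)
        (fun j => by simp [mulVec_neg, h]) i
      simpa using this
    · exact T.nonneg_of_groundedLaplacian_mulVec_nonneg (fun j => by simp [h]) i
  refine ⟨1 ᵥ* T.groundedLaplacian⁻¹, fun i => Finset.sum_nonneg fun k _ => ?_, ?_⟩
  · have := T.nonneg_of_groundedLaplacian_mulVec_nonneg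
      (v := T.groundedLaplacian⁻¹ *ᵥ Pi.single i 1) (fun j => by
        rw [mulVec_mulVec, mul_nonsing_inv _ hdet, one_mulVec]
        by_cases h : j = i
        · subst h; simp
        · simp [h]) k
    simpa using this
  · rw [vecMul_vecMul, nonsing_inv_mul _ hdet, vecMul_one]

/-- There are nonnegative weights, vanishing at the root of a spanning tree, for which the weighted
Laplacian dominates the identity on the functions that vanish at the root. -/
theorem DirectedSpanningTree.exists_weights :
    ∃ c : V → ℝ, (∀ i, 0 ≤ c i) ∧ c T.root = 0 ∧ ∀ η : V → ℝ, η T.root = 0 →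
      ∑ i, η i ^ 2 ≤ 2 * ∑ i, c i * ∑ j, G.W i j * (η i * (η i - η j)) := by
  obtain ⟨d, hd, hd1⟩ := T.exists_vecMul_groundedLaplacian_eq_one
  refine ⟨fun i => if i = T.root then 0 else d i, fun i => ?_, if_pos rfl, fun η hη => ?_⟩
  · dsimp only
    split_ifs
    exacts [le_rfl, hd i]
  set c : V → ℝ := fun i => if i = T.root then 0 else d i with hc
  have hc0 : ∀ i, 0 ≤ c i := fun i => by
    simp only [hc]
    split_ifs
    exacts [le_rfl, hd i]
  -- The root row meets only the root column, so zeroing the root weight does not disturb the other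
  -- columns.
  have hbal : ∀ j, j ≠ T.root → c j * (∑ k, G.W j k) - ∑ i, c i * G.W i j = 1 := by
    intro j hj
    have h1 := congrFun hd1 j
    rw [Pi.one_apply] at h1
    rw [← h1, vecMul, dotProduct]
    have : ∀ i, d i * T.groundedLaplacian i j
        = (if i = j then c j * ∑ k, G.W j k else 0) - c i * G.W i j := by
      intro i
      by_cases hi : i = T.root
      · simp [groundedLaplacian, hc, hi, hj, Ne.symm hj]
      · by_cases hij : i = j
        · subst hij
          simp [groundedLaplacian, hc, hi, mul_sub]
        · simp [groundedLaplacian, hc, hi, hij, Ne.symm hij]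
    simp [this]
  -- This is `(η i - η j)² ≥ 0`; summed, the left side collapses by `hbal`.
  have hterm : ∀ i j, c i * (G.W i j * η i ^ 2) - c i * (G.W i j * η j ^ 2)
      ≤ 2 * (c i * (G.W i j * (η i * (η i - η j)))) := fun i j => by
    nlinarith [mul_nonneg (mul_nonneg (hc0 i) (G.nonneg i j)) (sq_nonneg (η i - η j))]
  calc ∑ i, η i ^ 2
      = ∑ j, (c j * (∑ k, G.W j k) - ∑ i, c i * G.W i j) * η j ^ 2 := by
        refine Finset.sum_congr rfl fun j _ => ?_
        by_cases hj : j = T.root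
        · simp [hj, hη]
        · rw [hbal j hj, one_mul]
    _ = ∑ i, ∑ j, (c i * (G.W i j * η i ^ 2) - c i * (G.W i j * η j ^ 2)) := by
        simp only [sub_mul, Finset.sum_sub_distrib, Finset.sum_mul, Finset.mul_sum, mul_assoc]
        congr 1
        exact Finset.sum_comm
    _ ≤ ∑ i, ∑ j, 2 * (c i * (G.W i j * (η i * (η i - η j)))) :=
        Finset.sum_le_sum fun i _ => Finset.sum_le_sum fun j _ => hterm i j
    _ = _ := by simp only [Finset.mul_sum]

end GroundedLaplacian

/-! ### Lyapunov function and consensus gains -/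

section Lyapunov

variable {V : Type*} [Fintype V] {G : WeightedDigraph V}

theorem sum_dotProduct_self_le {κ : Type*} [Fintype κ] {r : V} {c : V → ℝ}
    (hc : ∀ η : V → ℝ, η r = 0 →
      ∑ i, η i ^ 2 ≤ 2 * ∑ i, c i * ∑ j, G.W i j * (η i * (η i - η j)))
    {η : V → κ → ℝ} (hη : η r = 0) :
    ∑ i, η i ⬝ᵥ η i ≤ -2 * ∑ i, c i * (η i ⬝ᵥ ∑ j, G.W i j • (η j - η i)) := by
  have h := Finset.sum_le_sum fun k (_ : k ∈ Finset.univ) =>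
    hc (fun i => η i k) (congrFun hη k)
  rw [Finset.sum_comm] at h
  simp only [dotProduct, ← sq]
  refine h.trans_eq ?_
  rw [← Finset.mul_sum, Finset.sum_comm, neg_mul, ← mul_neg, ← Finset.sum_neg_distrib]
  congr 1
  refine Finset.sum_congr rfl fun i _ => ?_
  rw [← Finset.mul_sum, ← mul_neg, Finset.sum_comm (s := Finset.univ (α := κ)),
    ← Finset.sum_neg_distrib, Finset.sum_comm]
  congr 1
  refine Finset.sum_congr rfl fun k _ => ?_
  rw [Finset.sum_apply, Finset.mul_sum, ← Finset.sum_neg_distrib]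
  refine Finset.sum_congr rfl fun j _ => ?_
  simp only [Pi.smul_apply, Pi.sub_apply, smul_eq_mul]
  ring

/-- With `p i = X⁻¹ ξ i` the left side is the derivative of the Lyapunov function. The matrix
inequality leaves an excess `s |Bᵀ p i|²`, which the weighted coupling absorbs by the choice of `c`.
-/
theorem sum_lyapunov_derivative_le {ι κ : Type*} [Fintype ι] [Fintype κ] {A X : Matrix ι ι ℝ}
    {B : Matrix ι κ ℝ} {s α : ℝ} (hX : Xᵀ = X) (hs : 0 ≤ s)
    (hle : ∀ u, u ⬝ᵥ ((A * X + X * Aᵀ - s • (B * Bᵀ) + α • X) *ᵥ u) ≤ 0) {r : V} {c : V → ℝ}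
    (hc : ∀ η : V → ℝ, η r = 0 →
      ∑ i, η i ^ 2 ≤ 2 * ∑ i, c i * ∑ j, G.W i j * (η i * (η i - η j)))
    {p : V → ι → ℝ} (hp : p r = 0) :
    ∑ i, 2 * (p i ⬝ᵥ (A *ᵥ (X *ᵥ p i) +
      (s * c i) • (B *ᵥ ∑ j, G.W i j • (Bᵀ *ᵥ p j - Bᵀ *ᵥ p i)))) ≤
      -α * ∑ i, p i ⬝ᵥ (X *ᵥ p i) := by
  have h1 := sum_dotProduct_self_le (G := G) hc (η := fun i => Bᵀ *ᵥ p i) (by simp [hp])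
  have h2 : ∀ u, 2 * (u ⬝ᵥ (A *ᵥ (X *ᵥ u))) ≤
      s * ((Bᵀ *ᵥ u) ⬝ᵥ (Bᵀ *ᵥ u)) - α * (u ⬝ᵥ (X *ᵥ u)) := by
    intro u
    have h := hle u
    have hXA : u ⬝ᵥ ((X * Aᵀ) *ᵥ u) = u ⬝ᵥ (A *ᵥ (X *ᵥ u)) := by
      rw [← mulVec_mulVec, dotProduct_mulVec, ← mulVec_transpose, hX, dotProduct_mulVec,
        vecMul_transpose, dotProduct_comm]
    have hBB : u ⬝ᵥ ((B * Bᵀ) *ᵥ u) = (Bᵀ *ᵥ u) ⬝ᵥ (Bᵀ *ᵥ u) := by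
      rw [← mulVec_mulVec, dotProduct_mulVec, ← mulVec_transpose]
    simp only [add_mulVec, sub_mulVec, smul_mulVec, dotProduct_add, dotProduct_sub,
      dotProduct_smul, smul_eq_mul, hXA, hBB] at h
    rw [← mulVec_mulVec] at h
    linarith
  have h3 : ∀ i, p i ⬝ᵥ (B *ᵥ ∑ j, G.W i j • (Bᵀ *ᵥ p j - Bᵀ *ᵥ p i))
      = (Bᵀ *ᵥ p i) ⬝ᵥ ∑ j, G.W i j • (Bᵀ *ᵥ p j - Bᵀ *ᵥ p i) := fun i => by
    rw [dotProduct_mulVec, ← mulVec_transpose]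
  simp only [dotProduct_add, dotProduct_smul, smul_eq_mul, h3, mul_add, Finset.sum_add_distrib]
  have h4 := Finset.sum_le_sum fun i (_ : i ∈ Finset.univ) => h2 (p i)
  rw [Finset.sum_sub_distrib, ← Finset.mul_sum, ← Finset.mul_sum, ← Finset.mul_sum] at h4
  have h5 := mul_le_mul_of_nonneg_left h1 hs
  have h6 : ∑ i, 2 * (s * c i * ((Bᵀ *ᵥ p i) ⬝ᵥ ∑ j, G.W i j • (Bᵀ *ᵥ p j - Bᵀ *ᵥ p i)))
      = 2 * s * ∑ i, c i * ((Bᵀ *ᵥ p i) ⬝ᵥ ∑ j, G.W i j • (Bᵀ *ᵥ p j - Bᵀ *ᵥ p i)) := by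
    rw [Finset.mul_sum]
    exact Finset.sum_congr rfl fun i _ => by ring
  rw [h6, ← Finset.mul_sum]
  linarith

/-- Exponential decay from a differential inequality. -/
theorem tendsto_zero_of_hasDerivWithinAt_le {f f' : ℝ → ℝ} {α : ℝ} (hα : 0 < α)
    (h0 : ∀ t, 0 ≤ f t) (hf : ∀ t, 0 ≤ t → HasDerivWithinAt f (f' t) (Ici 0) t)
    (hle : ∀ t, 0 ≤ t → f' t ≤ -α * f t) : Tendsto f atTop (𝓝 0) := by
  have hd : ∀ t, 0 ≤ t → HasDerivWithinAt (fun t => Real.exp (α * t) * f t)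
      (Real.exp (α * t) * α * f t + Real.exp (α * t) * f' t) (Ici 0) t := fun t ht => by
    have h1 : HasDerivAt (fun t : ℝ => α * t) α t := by simpa using (hasDerivAt_id t).const_mul α
    exact h1.exp.hasDerivWithinAt.mul (hf t ht)
  have hanti : AntitoneOn (fun t => Real.exp (α * t) * f t) (Ici 0) := by
    refine antitoneOn_of_hasDerivWithinAt_nonpos (convex_Ici 0)
      (fun t ht => (hd t ht).continuousWithinAt)
      (fun t ht => (hd t (interior_subset ht)).mono interior_subset) fun t ht => ?_
    have h1 := hle t (interior_subset ht)
    nlinarith [Real.exp_pos (α * t)]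
  have hbound : Tendsto (fun t => f 0 * Real.exp (-(α * t))) atTop (𝓝 0) := by
    have h1 : Tendsto (fun t : ℝ => -(α * t)) atTop atBot :=
      tendsto_neg_atTop_atBot.comp (tendsto_id.const_mul_atTop hα)
    simpa using (Real.tendsto_exp_atBot.comp h1).const_mul (f 0)
  refine tendsto_of_tendsto_of_tendsto_of_le_of_le' tendsto_const_nhds hbound
    (Eventually.of_forall h0) ?_
  filter_upwards [eventually_ge_atTop 0] with t ht
  have h1 := hanti (self_mem_Ici) ht ht
  simp only [mul_zero, Real.exp_zero, one_mul] at h1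
  rw [Real.exp_neg, ← div_eq_mul_inv, le_div_iff₀ (Real.exp_pos _), mul_comm]
  exact h1

theorem hasDerivWithinAt_dotProduct_mulVec {ι : Type*} [Fintype ι] {P : Matrix ι ι ℝ}
    (hP : Pᵀ = P) {ξ : ℝ → ι → ℝ} {ξ' : ι → ℝ} {S : Set ℝ} {t : ℝ}
    (h : HasDerivWithinAt ξ ξ' S t) :
    HasDerivWithinAt (fun t => ξ t ⬝ᵥ (P *ᵥ ξ t)) (2 * ((P *ᵥ ξ t) ⬝ᵥ ξ')) S t := by
  have hPξ : HasDerivWithinAt (fun t => P *ᵥ ξ t) (P *ᵥ ξ') S t :=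
    (LinearMap.toContinuousLinearMap P.mulVecLin).hasFDerivAt.comp_hasDerivWithinAt t h
  have h1 : HasDerivWithinAt (fun t => ∑ i, ξ t i * (P *ᵥ ξ t) i)
      (∑ i, (ξ' i * (P *ᵥ ξ t) i + ξ t i * (P *ᵥ ξ') i)) S t :=
    HasDerivWithinAt.fun_sum fun i _ =>
      (hasDerivWithinAt_pi.1 h i).mul (hasDerivWithinAt_pi.1 hPξ i)
  refine h1.congr_deriv ?_
  rw [Finset.sum_add_distrib]
  change ξ' ⬝ᵥ (P *ᵥ ξ t) + ξ t ⬝ᵥ (P *ᵥ ξ') = _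
  rw [dotProduct_mulVec (ξ t), ← mulVec_transpose, hP, dotProduct_comm ξ']
  ring

theorem tendsto_zero_of_dotProduct_mulVec {ι : Type*} [Fintype ι] [DecidableEq ι]
    {P : Matrix ι ι ℝ} (hP : P.PosDef) {ξ : ℝ → ι → ℝ} {l : Filter ℝ}
    (h : Tendsto (fun t => ξ t ⬝ᵥ (P *ᵥ ξ t)) l (𝓝 0)) : Tendsto ξ l (𝓝 0) := by
  obtain ⟨β, hβ, hle⟩ : ∃ β > 0, ∀ u, β * (u ⬝ᵥ u) ≤ u ⬝ᵥ (P *ᵥ u) := by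
    -- The coercivity constant comes from openness of the negative definite matrices around `-P`.
    have hmem : -P ∈ {M : Matrix ι ι ℝ | ∀ u, u ≠ 0 → u ⬝ᵥ (M *ᵥ u) < 0} := fun u hu => by
      have := hP.dotProduct_mulVec_pos hu
      rw [neg_mulVec, dotProduct_neg]
      simpa using this
    have hcont : Continuous fun β : ℝ => -P + β • (1 : Matrix ι ι ℝ) := by fun_prop
    have hnhds := hcont.continuousAt.preimage_mem_nhds (x := 0)
      (isOpen_setOf_forall_dotProduct_mulVec_neg.mem_nhds (by simpa using hmem))
    obtain ⟨β, h1, hβ⟩ := Filter.Eventually.exists (f := 𝓝[>] (0 : ℝ))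
      (Filter.Eventually.and (nhdsWithin_le_nhds hnhds) self_mem_nhdsWithin)
    refine ⟨β, hβ, fun u => ?_⟩
    by_cases hu : u = 0
    · simp [hu]
    · have h2 : u ⬝ᵥ ((-P + β • (1 : Matrix ι ι ℝ)) *ᵥ u) < 0 := h1 u hu
      rw [add_mulVec, neg_mulVec, smul_mulVec, one_mulVec, dotProduct_add, dotProduct_neg,
        dotProduct_smul, smul_eq_mul] at h2
      linarith
  refine tendsto_pi_nhds.2 fun i => ?_
  have hsq : Tendsto (fun t => ξ t i ^ 2) l (𝓝 0) := by
    refine squeeze_zero (fun t => sq_nonneg _) (fun t => ?_) (by simpa using h.const_mul β⁻¹)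
    rw [← div_eq_inv_mul, le_div_iff₀' hβ]
    refine le_trans ?_ (hle (ξ t))
    gcongr
    rw [sq]
    exact Finset.single_le_sum (f := fun j => ξ t j * ξ t j)
      (fun j _ => mul_self_nonneg _) (Finset.mem_univ i)
  have := hsq.sqrt
  simp only [Real.sqrt_sq_eq_abs, Real.sqrt_zero] at this
  exact (tendsto_zero_iff_abs_tendsto_zero _).2 this

/-- A stabilizable pair achieves consensus over a graph with a directed spanning tree. -/
theorem IsHautusStabilizable.achievesConsensus [DecidableEq V] (T : DirectedSpanningTree G)
    {n m : ℕ} {A : Matrix (Fin n) (Fin n) ℝ} {B : Matrix (Fin n) (Fin m) ℝ}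
    (hAB : IsHautusStabilizable A B) : AchievesConsensus G A B := by
  obtain ⟨X, s, α, hX, hs, hα, hle⟩ := hAB.exists_posDef
  obtain ⟨c, -, hcr, hc⟩ := T.exists_weights
  have hXT : Xᵀ = X := (conjTranspose_eq_transpose_of_trivial X).symm.trans hX.1
  have hP := hX.inv
  have hPT : (X⁻¹)ᵀ = X⁻¹ := (conjTranspose_eq_transpose_of_trivial _).symm.trans hP.1
  have hXP : X * X⁻¹ = 1 := mul_nonsing_inv _ ((isUnit_iff_isUnit_det _).1 hX.isUnit)
  have hXPv : ∀ v, X *ᵥ (X⁻¹ *ᵥ v) = v := fun v => by rw [mulVec_mulVec, hXP, one_mulVec]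
  refine ⟨fun i => (s * c i) • (Bᵀ * X⁻¹), fun x hx => ?_⟩
  set ξ : V → ℝ → Fin n → ℝ := fun i t => x i t - x T.root t with hξ
  have hder : ∀ i t, 0 ≤ t → HasDerivWithinAt (ξ i) (A *ᵥ ξ i t + (s * c i) • (B *ᵥ
      ∑ j, G.W i j • (Bᵀ *ᵥ (X⁻¹ *ᵥ ξ j t) - Bᵀ *ᵥ (X⁻¹ *ᵥ ξ i t)))) (Ici 0) t := by
    intro i t ht
    refine ((hx i t ht).sub (hx T.root t ht)).congr_deriv ?_
    have hsum : ∑ j, G.W i j • (Bᵀ *ᵥ (X⁻¹ *ᵥ ξ j t) - Bᵀ *ᵥ (X⁻¹ *ᵥ ξ i t))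
        = (Bᵀ * X⁻¹) *ᵥ info G (fun j => x j t) i := by
      rw [info_eq_sum, mulVec_sum]
      refine Finset.sum_congr rfl fun j _ => ?_
      rw [mulVec_smul, ← mulVec_sub, ← mulVec_sub, mulVec_mulVec, hξ]
      simp only [sub_sub_sub_cancel_right]
    -- Since `c` vanishes at the root, the root has no input and adds no coupling to the relative
    -- dynamics.
    simp only [hsum, hcr, mul_zero, zero_smul, zero_mulVec, mulVec_zero, add_zero, smul_mulVec,
      mulVec_smul]
    rw [hξ, mulVec_sub]
    abel
  have hquad : ∀ i t, 0 ≤ ξ i t ⬝ᵥ (X⁻¹ *ᵥ ξ i t) := fun i t => by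
    simpa using hP.posSemidef.dotProduct_mulVec_nonneg (ξ i t)
  have hV : Tendsto (fun t => ∑ i, ξ i t ⬝ᵥ (X⁻¹ *ᵥ ξ i t)) atTop (𝓝 0) := by
    refine tendsto_zero_of_hasDerivWithinAt_le hα (fun t => Finset.sum_nonneg fun i _ => hquad i t)
      (fun t ht => HasDerivWithinAt.fun_sum fun i _ =>
        hasDerivWithinAt_dotProduct_mulVec hPT (hder i t ht)) fun t ht => ?_
    have h1 := sum_lyapunov_derivative_le (G := G) hXT hs hle hc
      (p := fun i => X⁻¹ *ᵥ ξ i t) (by simp [hξ])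
    simpa only [hXPv, dotProduct_comm (X⁻¹ *ᵥ _) (ξ _ t)] using h1
  have hlim : ∀ i, Tendsto (ξ i) atTop (𝓝 0) := fun i =>
    tendsto_zero_of_dotProduct_mulVec hP (squeeze_zero (hquad i) (fun t =>
      Finset.single_le_sum (f := fun i => ξ i t ⬝ᵥ (X⁻¹ *ᵥ ξ i t))
        (fun j _ => hquad j t) (Finset.mem_univ i)) hV)
  intro i j
  refine tendsto_zero_iff_norm_tendsto_zero.1 ?_
  simpa [hξ] using (hlim i).sub (hlim j)

end Lyapunov

/-! ### Decentralized fixed modes -/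

section FixedModes

variable {V : Type*} [Fintype V] [DecidableEq V] {G : WeightedDigraph V}
  (T : DirectedSpanningTree G) {n m : ℕ}

/-- An uncontrollable mode of the agents is a mode of the transformed system for every gain. -/
theorem DirectedSpanningTree.mem_spectrum_of_uncontrollable (e : T.Edge)
    {A : Matrix (Fin n) (Fin n) ℝ} {B : Matrix (Fin n) (Fin m) ℝ} {μ : ℂ} {v : Fin n → ℂ}
    (hv : v ≠ 0) (hA : v ᵥ* A.map (algebraMap ℝ ℂ) = μ • v)
    (hB : v ᵥ* B.map (algebraMap ℝ ℂ) = 0) (K : Matrix (V × Fin m) (V × Fin n) ℝ) :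
    μ ∈ spectrum ℂ ((T.Astar A + T.Bstar B * K * T.Cstar n).map (algebraMap ℝ ℂ)) := by
  -- This is the unit vector at `e` tensored with `v`; it is killed by `P₀ᵀ ⊗ B`, so the feedback
  -- term never acts on it.
  set w : T.Edge × Fin n → ℂ := fun p => if p.1 = e then v p.2 else 0 with hw
  have hwA : w ᵥ* (T.Astar A).map (algebraMap ℝ ℂ) = μ • w := by
    ext ⟨f, a⟩
    have h := congrFun hA a
    simp only [vecMul, dotProduct, map_apply, Pi.smul_apply] at h
    simp only [hw, Astar, vecMul, dotProduct, Fintype.sum_prod_type, map_apply, kroneckerMap_apply,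
      one_apply, ite_mul, zero_mul, Pi.smul_apply]
    rw [Finset.sum_comm]
    by_cases hf : f = e
    · subst hf
      simpa using h
    · simp [hf, Ne.symm hf]
  have hwB : w ᵥ* (T.Bstar B).map (algebraMap ℝ ℂ) = 0 := by
    ext ⟨i, k⟩
    have h := congrFun hB k
    simp only [vecMul, dotProduct, map_apply, Pi.zero_apply] at h
    simp only [hw, Bstar, vecMul, dotProduct, Fintype.sum_prod_type, map_apply, kroneckerMap_apply,
      transpose_apply, ite_mul, zero_mul, Pi.zero_apply, map_mul]
    rw [Finset.sum_comm]
    simp only [Finset.sum_ite_eq', Finset.mem_univ, if_true, mul_left_comm (v _)]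
    rw [← Finset.mul_sum, h, mul_zero]
  refine mem_spectrum_of_vecMul_eq_smul (v := w) ?_ ?_
  · obtain ⟨a, ha⟩ := Function.ne_iff.1 hv
    exact Function.ne_iff.2 ⟨(e, a), by simpa [hw] using ha⟩
  · rw [Matrix.map_add _ (map_add _), Matrix.map_mul, Matrix.map_mul, vecMul_add, hwA,
      ← vecMul_vecMul, ← vecMul_vecMul, hwB, zero_vecMul, zero_vecMul, add_zero]

theorem DirectedSpanningTree.achievesConsensus_iff_isStabilizable (A : Matrix (Fin n) (Fin n) ℝ)
    (B : Matrix (Fin n) (Fin m) ℝ) :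
    AchievesConsensus G A B ↔
      IsStabilizable (T.Cstar n) (T.Astar A) (T.Bstar B) (diagGains V m n) := by
  simp [AchievesConsensus, IsStabilizable, diagGains, T.reachesConsensus_iff]

theorem DirectedSpanningTree.achievesConsensus_iff_fixedModes (A : Matrix (Fin n) (Fin n) ℝ)
    (B : Matrix (Fin n) (Fin m) ℝ) :
    AchievesConsensus G A B ↔
      ∀ μ ∈ fixedModes (T.Cstar n) (T.Astar A) (T.Bstar B) (diagGains V m n),
        ¬ (μ ∈ spectrum ℂ ((T.Astar A).map (algebraMap ℝ ℂ)) ∧ 0 ≤ μ.re) := by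
  constructor
  · rintro ⟨K, hK⟩ μ hμ ⟨-, hre⟩
    exact hre.not_gt (((T.reachesConsensus_iff A B K).1 hK).re_neg
      (mem_iInter₂.1 hμ (diagGain K) ⟨K, rfl⟩))
  · intro h
    by_cases hV : Nonempty T.Edge
    · obtain ⟨e⟩ := hV
      refine IsHautusStabilizable.achievesConsensus T fun μ v hre hA hB => ?_
      by_contra hv
      have hspec := T.mem_spectrum_of_uncontrollable e hv hA hB
      -- The zero gain places `μ` in the spectrum of `A*`.
      exact h μ (mem_iInter₂.2 fun K _ => hspec K) ⟨by simpa using hspec 0, hre⟩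
    -- With a single agent there are no edges to carry a mode, and consensus is trivial.
    · have hroot : ∀ v, v = T.root := fun v => by
        by_contra hv
        exact hV ⟨⟨v, hv⟩⟩
      exact ⟨0, fun x _ i j => by simp [hroot i, hroot j]⟩

end FixedModes

end MASConsensus

theorem lemma2 {V : Type*} [Fintype V] [DecidableEq V] (G : MASConsensus.WeightedDigraph V)
    (T : MASConsensus.DirectedSpanningTree G) {n m : ℕ}
    (A : Matrix (Fin n) (Fin n) ℝ) (B : Matrix (Fin n) (Fin m) ℝ) :
    -- the fundamental edge states of the multi-agent system obey exactly the transformed system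
    (∀ (K : V → Matrix (Fin m) (Fin n) ℝ) (y : ℝ → T.Edge × Fin n → ℝ),
      MASConsensus.IsTrajectory
          (T.Astar A + T.Bstar B * MASConsensus.diagGain K * T.Cstar n) y ↔
        ∃ x : V → ℝ → Fin n → ℝ, MASConsensus.IsMASTrajectory G A B K x ∧
          ∀ t, 0 ≤ t → y t = T.edgeState (fun i => x i t)) ∧
    -- given gains yield consensus if and only if they stabilize the transformed system
    (∀ K : V → Matrix (Fin m) (Fin n) ℝ,
      MASConsensus.ReachesConsensus G A B K ↔
        MASConsensus.IsAsymptoticallyStable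
          (T.Astar A + T.Bstar B * MASConsensus.diagGain K * T.Cstar n)) ∧
    -- consensus is achievable if and only if the transformed system is stabilizable
    (MASConsensus.AchievesConsensus G A B ↔
      MASConsensus.IsStabilizable (T.Cstar n) (T.Astar A) (T.Bstar B)
        (MASConsensus.diagGains V m n)) ∧
    -- the criterion in terms of decentralized fixed modes
    (MASConsensus.AchievesConsensus G A B ↔
      ∀ μ ∈ MASConsensus.fixedModes (T.Cstar n) (T.Astar A) (T.Bstar B)
          (MASConsensus.diagGains V m n),
        ¬ (μ ∈ spectrum ℂ ((T.Astar A).map (algebraMap ℝ ℂ)) ∧ 0 ≤ μ.re)) := by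
  exact ⟨T.isTrajectory_iff A B, T.reachesConsensus_iff A B,
    T.achievesConsensus_iff_isStabilizable A B, T.achievesConsensus_iff_fixedModes A B⟩
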